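/- All graphs are finite, simple and undirected, and $d$ denotes the shortest-path distance. For a connected graph $G$ and a sequence of vertices put $\ell(x_0,\ldots,x_k)=\sum_{i=0}^{k-1} d(x_i,x_{i+1})$. For $k,l\ge 0$ let $MC_{k,l}(G)$ be the free abelian group on the sequences $(x_0,\ldots,x_k)\in V(G)^{k+1}$ with $x_i\ne x_{i+1}$ for all $0\le i<k$ and $\ell(x_0,\ldots,x_k)=l$, with differential $\partial=\sum_{i=1}^{k-1}(-1)^i\partial_i: MC_{k,l}(G)\to MC_{k-1,l}(G)$, where $\partial_i(x_0,\ldots,x_k)=(x_0,\ldots,\widehat{x_i},\ldots,x_k)$ if omitting $x_i$ does not change the length $\ell$, and $\partial_i(x_0,\ldots,x_k)=0$ otherwise. The magnitude homology of $G$ is $MH_{k,l}(G)=H_k(MC_{*,l}(G))$, and $G$ is called diagonal if $MH_{k,l}(G)=0$ whenever $k\neq l$. A graph $G$ is called pawful if it is connected, has diameter at most $2$, and for any vertices $u,v,w$ with $d(u,v)=d(v,w)=2$ and $d(u,w)=1$ there is a vertex $x$ with $d(x,u)=d(x,v)=d(x,w)=1$. The join of two graphs $H$ and $K$ is the disjoint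 union of $H$ and $K$ together with all edges between a vertex of $H$ and a vertex of $K$; a graph is called a join if it is isomorphic to the join of two non-empty graphs (graphs with at least one vertex). Theorem. (1) Every pawful graph is diagonal. (2) The class of pawful graphs strictly contains the class of joins: every join is pawful, and for every $n\ge 6$ the complement of the cycle graph $C_n$ is pawful but is not a join. -/

import Mathlib

universe u

namespace MagnitudeHomology

open CategoryTheory

/-- The length `ℓ(x₀, …, x_k) = ∑ d(x_i, x_{i+1})` of a sequence of vertices. The distance is the
extended graph distance, which is `⊤` between different components. -/
noncomputable def length {V : Type u} (G : SimpleGraph V) {k : ℕ} (x : Fin (k + 1) → V) : ℕ∞ :=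
  ∑ i : Fin k, G.edist (x i.castSucc) (x i.succ)

/-- The generators of `MC_{k,l}(G)`: sequences `(x₀, …, x_k)` of vertices with
`x_i ≠ x_{i+1}` for all `i`, and of length `l`. -/
@[ext]
structure Generator {V : Type u} (G : SimpleGraph V) (k l : ℕ) : Type u where
  seq : Fin (k + 1) → V
  ne : ∀ i : Fin k, seq i.castSucc ≠ seq i.succ
  length_eq : length G seq = (l : ℕ∞)

/-- The sequence `(x₀, …, x_{k+1})` with the interior entry `x_{i+1}` omitted
(where `0 ≤ i < k`). -/
def omit1 {V : Type u} {k : ℕ} (x : Fin (k + 2) → V) (i : Fin k) : Fin (k + 1) → V :=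
  fun j => x (i.castSucc.succ.succAbove j)

theorem length_succ {V : Type u} (G : SimpleGraph V) {k : ℕ} (x : Fin (k + 2) → V) :
    length G x = G.edist (x 0) (x 1) + length G (fun j => x j.succ) := by
  unfold length
  rw [Fin.sum_univ_succ]
  rfl

theorem omit1_zero_zero {V : Type u} {k : ℕ} (x : Fin (k + 3) → V) :
    omit1 x 0 0 = x 0 := rfl

theorem omit1_zero_succ {V : Type u} {k : ℕ} (x : Fin (k + 3) → V) (j : Fin (k + 1)) :
    omit1 x 0 j.succ = x j.succ.succ := by
  unfold omit1
  congr 1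

theorem omit1_succ_zero {V : Type u} {k : ℕ} (x : Fin (k + 3) → V) (i : Fin k) :
    omit1 x i.succ 0 = x 0 := rfl

theorem omit1_succ_succ {V : Type u} {k : ℕ} (x : Fin (k + 3) → V) (i : Fin k)
    (j : Fin (k + 1)) :
    omit1 x i.succ j.succ = omit1 (fun m => x m.succ) i j := by
  unfold omit1
  rw [← Fin.succ_castSucc, Fin.succ_succAbove_succ]

theorem length_omit1 {V : Type u} (G : SimpleGraph V) {k : ℕ} (x : Fin (k + 2) → V)
    (i : Fin k) :
    length G x + G.edist (x i.castSucc.castSucc) (x i.succ.succ) =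
      length G (omit1 x i) + (G.edist (x i.castSucc.castSucc) (x i.castSucc.succ) +
        G.edist (x i.castSucc.succ) (x i.succ.succ)) := by
  induction k with
  | zero => exact i.elim0
  | succ k ih =>
    refine Fin.cases ?_ (fun i => ?_) i
    · rw [length_succ, length_succ, length_succ G (omit1 x 0)]
      simp only [omit1_zero_succ, omit1_zero_zero]
      have h : omit1 x 0 1 = x 2 := omit1_zero_succ x 0
      rw [h]
      change G.edist (x 0) (x 1) + (G.edist (x 1) (x 2) + _) + G.edist (x 0) (x 2) =
        G.edist (x 0) (x 2) + _ + (G.edist (x 0) (x 1) + G.edist (x 1) (x 2))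
      abel
    · rw [length_succ, length_succ G (omit1 x i.succ)]
      have h := ih (fun m => x m.succ) i
      have h1 : omit1 x i.succ 1 = x 1 := by
        have := omit1_succ_succ x i 0
        simp only [Fin.succ_zero_eq_one] at this
        rw [this]
        cases k with
        | zero => exact i.elim0
        | succ k => rfl
      simp only [omit1_succ_succ, omit1_succ_zero, h1]
      change length G (fun j => x j.succ) +
        G.edist (x i.succ.castSucc.castSucc) (x i.succ.succ.succ) =
        length G (omit1 (fun m => x m.succ) i) +
        (G.edist (x i.succ.castSucc.castSucc) (x i.succ.castSucc.succ) +
          G.edist (x i.succ.castSucc.succ) (x i.succ.succ.succ)) at h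
      rw [add_assoc, h]
      exact (add_assoc _ _ _).symm

theorem length_omit1_le {V : Type u} (G : SimpleGraph V) {k : ℕ} (x : Fin (k + 2) → V)
    (i : Fin k) : length G (omit1 x i) ≤ length G x := by
  by_cases h : length G x = ⊤
  · simp [h]
  have hx := length_omit1 G x i
  have ht : G.edist (x i.castSucc.castSucc) (x i.succ.succ) ≤ _ :=
    G.edist_triangle (v := x i.castSucc.succ)
  have h1 : G.edist (x i.castSucc.castSucc) (x i.castSucc.succ) ≠ ⊤ := by
    intro h1
    apply h
    rw [length]
    exact WithTop.sum_eq_top.2 ⟨i.castSucc, Finset.mem_univ _, h1⟩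
  have h2 : G.edist (x i.castSucc.succ) (x i.succ.succ) ≠ ⊤ := by
    intro h2
    apply h
    rw [length]
    exact WithTop.sum_eq_top.2 ⟨i.succ, Finset.mem_univ _, h2⟩
  have h3 : G.edist (x i.castSucc.castSucc) (x i.castSucc.succ) +
    G.edist (x i.castSucc.succ) (x i.succ.succ) ≠ ⊤ := by simp [h1, h2]
  have : length G (omit1 x i) + (G.edist (x i.castSucc.castSucc) (x i.castSucc.succ) +
    G.edist (x i.castSucc.succ) (x i.succ.succ)) ≤ length G x +
    (G.edist (x i.castSucc.castSucc) (x i.castSucc.succ) +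
    G.edist (x i.castSucc.succ) (x i.succ.succ)) := by
    rw [← hx]
    gcongr
  exact (ENat.add_le_add_iff_right h3).1 this

theorem omit1_ne {V : Type u} {k : ℕ} (x : Fin (k + 2) → V)
    (hx : ∀ i : Fin (k + 1), x i.castSucc ≠ x i.succ) (i : Fin k)
    (hi : x i.castSucc.castSucc ≠ x i.succ.succ) (j : Fin k) :
    omit1 x i j.castSucc ≠ omit1 x i j.succ := by
  induction k with
  | zero => exact i.elim0
  | succ k ih =>
    revert hi
    refine Fin.cases ?_ (fun i => ?_) i <;> refine Fin.cases ?_ (fun j => ?_) j <;> intro hi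
    · exact hi
    · rw [← Fin.succ_castSucc, omit1_zero_succ, omit1_zero_succ]
      exact hx j.succ.succ
    · have h1 := omit1_succ_succ x i 0
      rw [h1]
      cases k with
      | zero => exact i.elim0
      | succ k => exact hx 0
    · rw [← Fin.succ_castSucc, omit1_succ_succ, omit1_succ_succ]
      exact ih (fun m => x m.succ) (fun m => hx m.succ) i hi j

/-- An interior face that keeps the length of a generator is again a generator. -/
theorem omit1_mem {V : Type u} (G : SimpleGraph V) {k l : ℕ} (x : Generator G (k + 1) l)
    (i : Fin k) (h : length G (omit1 x.seq i) = length G x.seq) :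
    (∀ j : Fin k, omit1 x.seq i j.castSucc ≠ omit1 x.seq i j.succ) ∧
      length G (omit1 x.seq i) = (l : ℕ∞) := by
  refine ⟨omit1_ne x.seq x.ne i ?_, h.trans x.length_eq⟩
  intro he
  have hl := length_omit1 G x.seq i
  have hfin : length G x.seq ≠ ⊤ := by
    rw [x.length_eq]
    exact ENat.natCast_ne_top l
  rw [h, he, SimpleGraph.edist_self] at hl
  have h1 := ENat.add_right_injective_of_ne_top hfin hl
  have h0 : G.edist (x.seq i.castSucc.castSucc) (x.seq i.castSucc.succ) = 0 := by
    rw [he]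
    exact (add_eq_zero.1 h1.symm).1
  exact x.ne i.castSucc (SimpleGraph.edist_eq_zero_iff.1 h0)

open Classical in
/-- `∂_{i+1}(x₀, …, x_{k+1})`: omit the interior entry `x_{i+1}` if this keeps the length,
and `0` otherwise. -/
noncomputable def face {V : Type u} (G : SimpleGraph V) {k l : ℕ} (i : Fin k)
    (x : Generator G (k + 1) l) : Generator G k l →₀ ℤ :=
  if h : length G (omit1 x.seq i) = length G x.seq then
    Finsupp.single ⟨omit1 x.seq i, (omit1_mem G x i h).1, (omit1_mem G x i h).2⟩ 1
  else 0

/-- The differential `∂ = ∑_{1 ≤ i ≤ k} (-1)^i ∂_i : MC_{k+1,l}(G) → MC_{k,l}(G)`. -/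
noncomputable def boundary {V : Type u} (G : SimpleGraph V) (k l : ℕ) :
    (Generator G (k + 1) l →₀ ℤ) →ₗ[ℤ] (Generator G k l →₀ ℤ) :=
  Finsupp.linearCombination ℤ fun x => ∑ i : Fin k, (-1 : ℤ) ^ (i.val + 1) • face G i x

theorem omit1_omit1 {V : Type u} {k : ℕ} (x : Fin (k + 3) → V) (i j : Fin k) (h : i ≤ j) :
    omit1 (omit1 x j.succ) i = omit1 (omit1 x i.castSucc) j := by
  funext m
  unfold omit1
  congr 1
  ext
  simp only [Fin.succAbove, Fin.lt_def, Fin.val_castSucc, Fin.val_succ]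
  have : i.val ≤ j.val := h
  split_ifs <;> simp_all <;> omega

theorem alternating_sum_eq_zero {M : Type*} [AddCommGroup M] (k : ℕ)
    (a : Fin (k + 1) → Fin k → M)
    (ha : ∀ i j : Fin k, i ≤ j → a j.succ i = a i.castSucc j) :
    ∑ i : Fin (k + 1), ∑ j : Fin k, ((-1 : ℤ) ^ (i.val + 1) * (-1) ^ (j.val + 1)) • a i j = 0 := by
  rw [← Finset.sum_product', Finset.univ_product_univ]
  rw [← Finset.sum_filter_add_sum_filter_not _ (fun p : Fin (k + 1) × Fin k => p.1 ≤ p.2.castSucc)]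
  rw [← eq_neg_iff_add_eq_zero, ← Finset.sum_neg_distrib]
  refine Finset.sum_bij'
    (fun p hp => (p.2.succ, p.1.castLT
      (lt_of_le_of_lt (Fin.le_def.1 (Finset.mem_filter.1 hp).2) p.2.isLt)))
    (fun p hp => (p.2.castSucc, p.1.pred
      (by rintro h; have := (Finset.mem_filter.1 hp).2; rw [h] at this; exact this (Fin.zero_le _))))
    ?_ ?_ ?_ ?_ ?_
  · rintro ⟨i, j⟩ hp
    simp only [Finset.mem_filter, Finset.mem_univ, true_and, Fin.le_def, Fin.val_castSucc,
      Fin.val_succ, Fin.val_castLT] at hp ⊢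
    omega
  · rintro ⟨i, j⟩ hp
    simp only [Finset.mem_filter, Finset.mem_univ, true_and, Fin.le_def, Fin.val_castSucc,
      Fin.val_pred] at hp ⊢
    omega
  · rintro ⟨i, j⟩ hp
    simp
  · rintro ⟨i, j⟩ hp
    simp
  · rintro ⟨i, j⟩ hp
    have hij : i.val ≤ j.val := (Finset.mem_filter.1 hp).2
    have hi : i.val < k := lt_of_le_of_lt hij j.isLt
    have := ha ⟨i.val, hi⟩ j hij
    change _ = -(((-1 : ℤ) ^ (j.val + 1 + 1) * (-1) ^ (i.val + 1)) • a j.succ ⟨i.val, hi⟩)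
    rw [this, ← neg_smul]
    congr 1
    ring

/-- The inclusion of chains into formal combinations of all sequences. -/
noncomputable def forget {V : Type u} (G : SimpleGraph V) (k l : ℕ) :
    (Generator G k l →₀ ℤ) →ₗ[ℤ] ((Fin (k + 1) → V) →₀ ℤ) :=
  Finsupp.lmapDomain ℤ ℤ Generator.seq

open Classical in
theorem forget_face {V : Type u} (G : SimpleGraph V) {k l : ℕ} (i : Fin k)
    (x : Generator G (k + 1) l) :
    forget G k l (face G i x) =
      if length G (omit1 x.seq i) = (l : ℕ∞) then Finsupp.single (omit1 x.seq i) 1 else 0 := by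
  rw [← x.length_eq]
  unfold face forget
  split_ifs with h
  · simp [Finsupp.mapDomain_single]
  · simp

open Classical in
theorem forget_boundary_face {V : Type u} (G : SimpleGraph V) {k l : ℕ} (i : Fin (k + 1))
    (x : Generator G (k + 2) l) :
    forget G k l (boundary G k l (face G i x)) =
      ∑ j : Fin k, (-1 : ℤ) ^ (j.val + 1) •
        if length G (omit1 (omit1 x.seq i) j) = (l : ℕ∞)
          then Finsupp.single (omit1 (omit1 x.seq i) j) (1 : ℤ) else 0 := by
  unfold face
  split_ifs with h
  · unfold boundary
    rw [Finsupp.linearCombination_single, one_smul, map_sum]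
    refine Finset.sum_congr rfl fun j _ => ?_
    rw [map_smul, forget_face]
  · rw [map_zero, map_zero]
    symm
    refine Finset.sum_eq_zero fun j _ => ?_
    rw [if_neg, smul_zero]
    intro hj
    apply h
    apply le_antisymm (length_omit1_le G x.seq i)
    rw [x.length_eq, ← hj]
    exact length_omit1_le G (omit1 x.seq i) j

theorem boundary_comp_boundary {V : Type u} (G : SimpleGraph V) (k l : ℕ) :
    boundary G k l ∘ₗ boundary G (k + 1) l = 0 := by
  classical
  refine Finsupp.lhom_ext' fun x => LinearMap.ext_ring ?_
  have hinj : Function.Injective (forget G k l) :=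
    Finsupp.mapDomain_injective fun _ _ h => Generator.ext h
  apply hinj
  simp only [LinearMap.comp_apply, Finsupp.lsingle_apply, LinearMap.zero_apply, map_zero]
  conv_lhs => rw [boundary.eq_def G (k + 1) l]
  rw [Finsupp.linearCombination_single, one_smul, map_sum, map_sum]
  simp only [map_smul, forget_boundary_face, Finset.smul_sum, smul_smul]
  refine alternating_sum_eq_zero k (fun i j =>
    if length G (omit1 (omit1 x.seq i) j) = (l : ℕ∞)
      then Finsupp.single (omit1 (omit1 x.seq i) j) (1 : ℤ) else 0) fun i j hij => ?_
  simp only [omit1_omit1 x.seq i j hij]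

/-- The magnitude chain complex `MC_{*,l}(G)`. -/
noncomputable def magnitudeComplex {V : Type u} (G : SimpleGraph V) (l : ℕ) :
    ChainComplex (ModuleCat.{u} ℤ) ℕ :=
  ChainComplex.of (fun k => ModuleCat.of ℤ (Generator G k l →₀ ℤ))
    (fun k => ModuleCat.ofHom (boundary G k l))
    (fun k => by
      rw [← ModuleCat.ofHom_comp, boundary_comp_boundary]
      rfl)

/-- Magnitude homology `MH_{k,l}(G) = H_k(MC_{*,l}(G))`. -/
noncomputable def MH {V : Type u} (G : SimpleGraph V) (k l : ℕ) : ModuleCat.{u} ℤ :=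
  (magnitudeComplex G l).homology k

/-- A graph is diagonal if `MH_{k,l}(G) ≠ 0` only if `k = l`. -/
def IsDiagonal {V : Type u} (G : SimpleGraph V) : Prop :=
  ∀ k l : ℕ, k ≠ l → Limits.IsZero (MH G k l)

/-- Pawful graphs. -/
def IsPawful {V : Type u} (G : SimpleGraph V) : Prop :=
  G.Connected ∧ G.ediam ≤ 2 ∧
    ∀ u v w : V, G.dist u v = 2 → G.dist v w = 2 → G.dist u w = 1 →
      ∃ x : V, G.dist x u = 1 ∧ G.dist x v = 1 ∧ G.dist x w = 1

/-- The join of two graphs: their disjoint union together with all edges between the two. -/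
def join {V W : Type u} (G : SimpleGraph V) (H : SimpleGraph W) : SimpleGraph (V ⊕ W) :=
  (G ⊕g H) ⊔ completeBipartiteGraph V W

/-- A graph is a join if it is isomorphic to the join of two non-empty graphs. -/
def IsJoin {V : Type u} (G : SimpleGraph V) : Prop :=
  ∃ (A B : Type u) (H : SimpleGraph A) (K : SimpleGraph B),
    Nonempty A ∧ Nonempty B ∧ Nonempty (G ≃g join H K)

end MagnitudeHomology

/-! Interior faces never remove the first vertex, so the magnitude complex splits by starting vertex
`a`. In diameter at most two, an entry `b` between `a'` and `c` can be omitted exactly when `a'`,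
`b`, `c` is an induced path. A generator has length at least its degree, so diagonality means that
every cycle with positive degree `k < l` bounds.

The main step (`exists_listBoundary_eq_consChain`) fills `(a, c, z)`, where `d(a, c) = 2` and `z` is
a cycle starting at `c`. For a midpoint `m` of `a` and `c`, the boundary of `(a, m, c, z)` contains
`(a, c, z)` up to sign, plus error terms in which `c` is omitted after `m`. Each error term is again
a prefixed cycle, `(m, x, z_x)` with `d(m, x) = 2`, and is filled by induction. The fillers must not
create new terms when `a, m` is put in front of them, which is ensured by choosing their first
vertices equal or adjacent to `a`. Pawfulness provides such midpoints: `HasNearMidpoints` is the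
condition that makes the induction close.

A general cycle (`exists_listBoundary_eq`) is first changed by a boundary so that no sequence starts
with an edge; what remains is a sum of prefixed cycles as above.

For the second claim, the complement of a join is disconnected, whereas that of a cycle complement
is a connected cycle. The common neighbours required by pawfulness come from the other side of a
join, or from the vertex three steps further along the cycle. -/

namespace MagnitudeHomology

/-! ### Chains with a fixed starting vertex, and filling of cycles -/

section ListChains

open scoped Classical

/-- The vertex `b` can be omitted from a sequence `…, a, b, c, …` without changing the length,
in a graph of diameter at most two. -/
def Merges {V : Type u} (G : SimpleGraph V) (a b c : V) : Prop :=
  G.Adj a b ∧ G.Adj b c ∧ a ≠ c ∧ ¬ G.Adj a c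

/-- The magnitude differential on chains of sequences starting at `a`. A chain is a function of
the remaining entries of the sequence. -/
noncomputable def listBoundary {V : Type u} [Fintype V] (G : SimpleGraph V) :
    V → (List V → ℤ) → List V → ℤ
  | _, _, [] => 0
  | a, z, c :: t => -(∑ b, if Merges G a b c then z (b :: c :: t) else 0) -
      listBoundary G c (fun s => z (c :: s)) t

/-- The tails of the sequences starting at `a` with `k` steps and of length `l`, in a graph of
diameter at most two. -/
def IsTail {V : Type u} (G : SimpleGraph V) : ℕ → ℕ → V → List V → Prop
  | k, l, _, [] => k = 0 ∧ l = 0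
  | k, l, a, b :: t => ∃ k', k = k' + 1 ∧
      ((G.Adj a b ∧ ∃ l', l = l' + 1 ∧ IsTail G k' l' b t) ∨
        (a ≠ b ∧ ¬ G.Adj a b ∧ ∃ l', l = l' + 2 ∧ IsTail G k' l' b t))

/-- Chains of sequences starting at `a`, with `k` steps and of length `l`. -/
def IsChainOn {V : Type u} (G : SimpleGraph V) (k l : ℕ) (a : V) (z : List V → ℤ) : Prop :=
  ∀ t, z t ≠ 0 → IsTail G k l a t

/-- Prepend a vertex to all sequences of a chain. -/
noncomputable def consChain {V : Type u} (c : V) (z : List V → ℤ) : List V → ℤ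
  | [] => 0
  | x :: t => if x = c then z t else 0

variable {V : Type u} [Fintype V] {G : SimpleGraph V}

theorem listBoundary_add (a : V) (y z : List V → ℤ) :
    listBoundary G a (fun s => y s + z s) = fun t => listBoundary G a y t + listBoundary G a z t := by
  funext t
  induction t generalizing a y z with
  | nil => simp [listBoundary]
  | cons c t ih =>
    simp only [listBoundary, ih]
    have : ∀ b, (if Merges G a b c then y (b :: c :: t) + z (b :: c :: t) else 0) =
        (if Merges G a b c then y (b :: c :: t) else 0) +
          (if Merges G a b c then z (b :: c :: t) else 0) := by
      intro b; split_ifs <;> simp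
    rw [Finset.sum_congr rfl fun b _ => this b, Finset.sum_add_distrib]
    ring

theorem listBoundary_mul (a : V) (r : ℤ) (z : List V → ℤ) :
    listBoundary G a (fun s => r * z s) = fun t => r * listBoundary G a z t := by
  funext t
  induction t generalizing a z with
  | nil => simp [listBoundary]
  | cons c t ih =>
    simp only [listBoundary, ih, mul_sub, mul_neg, Finset.mul_sum, mul_ite, mul_zero]

theorem listBoundary_neg (a : V) (z : List V → ℤ) :
    listBoundary G a (fun s => -z s) = fun t => -listBoundary G a z t := by
  simpa using listBoundary_mul (G := G) a (-1) z

theorem listBoundary_zero (a : V) : listBoundary G a (fun _ => 0) = fun _ => 0 := by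
  have h := listBoundary_add (G := G) a (fun _ => 0) (fun _ => 0)
  funext t
  have := congrFun h t
  simpa using this

theorem listBoundary_sum {ι : Type*} (s : Finset ι) (a : V) (f : ι → List V → ℤ) :
    listBoundary G a (fun t => ∑ i ∈ s, f i t) = fun t => ∑ i ∈ s, listBoundary G a (f i) t := by
  classical
  induction s using Finset.induction_on with
  | empty => simpa using listBoundary_zero a
  | insert i s hi ih =>
    simp only [Finset.sum_insert hi]
    rw [listBoundary_add, ih]

theorem listBoundary_ite (p : Prop) (a : V) (z : List V → ℤ) :
    listBoundary G a (fun s => if p then z s else 0) =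
      fun t => if p then listBoundary G a z t else 0 := by
  split_ifs
  · rfl
  · exact listBoundary_zero a

/-- Omitting a vertex leaves a pair at distance two, so an edge `a, c` never arises from an omission
between its ends. Hence the part of a cycle that begins with a given edge is itself a cycle after
removing `a`. -/
theorem listBoundary_cons_of_adj {a c : V} (h : G.Adj a c) (z : List V → ℤ) (t : List V) :
    listBoundary G a z (c :: t) = -listBoundary G c (fun s => z (c :: s)) t := by
  have : ∀ b, ¬ Merges G a b c := fun b hb => hb.2.2.2 h
  simp [listBoundary, this]

/-- The omissions of `b` between `a` and `c` combined with an omission further along appear in both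
orders with opposite signs. Omissions on either side of an edge `a, b` or `b, c` cannot interfere,
since a new pair is never an edge. -/
theorem listBoundary_listBoundary (a : V) (z : List V → ℤ) :
    listBoundary G a (listBoundary G a z) = fun _ => 0 := by
  funext t
  induction t generalizing a z with
  | nil => simp [listBoundary]
  | cons c t ih =>
    have h1 : (fun s => listBoundary G a z (c :: s)) = fun s =>
        -((∑ b, if Merges G a b c then z (b :: c :: s) else 0) +
          listBoundary G c (fun s => z (c :: s)) s) := by
      funext s; simp only [listBoundary]; ring
    rw [listBoundary, h1, listBoundary_neg, listBoundary_add, listBoundary_sum]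
    simp only [ih, listBoundary_ite, add_zero, sub_neg_eq_add, neg_add_eq_zero]
    refine Finset.sum_congr rfl fun b _ => ?_
    split_ifs with h
    · rw [listBoundary_cons_of_adj h.1, listBoundary_cons_of_adj h.2.1, neg_neg]
    · rfl

/-- A Leibniz rule: either the prepended vertex `c` is omitted, or the differential acts behind it
with a change of sign. -/
theorem listBoundary_consChain (a c : V) (z : List V → ℤ) (x : V) (t : List V) :
    listBoundary G a (consChain c z) (x :: t) =
      -(if Merges G a c x then z (x :: t) else 0) -
        consChain c (listBoundary G c z) (x :: t) := by
  simp only [listBoundary, consChain, listBoundary_ite]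
  congr 1
  · rw [Finset.sum_eq_single c]
    · simp
    · intro b _ hb
      simp [hb]
    · simp
  · split_ifs with h
    · rw [h]
    · rfl

omit [Fintype V] in
theorem isTail_cons_of_adj {k l : ℕ} {a b : V} {t : List V} (h : G.Adj a b) :
    IsTail G (k + 1) (l + 1) a (b :: t) ↔ IsTail G k l b t := by
  simp [IsTail, h]

omit [Fintype V] in
theorem isTail_cons_of_not_adj {k l : ℕ} {a b : V} {t : List V} (hab : a ≠ b) (h : ¬ G.Adj a b) :
    IsTail G (k + 1) (l + 2) a (b :: t) ↔ IsTail G k l b t := by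
  simp [IsTail, h, hab]

theorem IsChainOn.listBoundary {k l : ℕ} {a : V} {z : List V → ℤ} (hz : IsChainOn G (k + 1) l a z) :
    IsChainOn G k l a (listBoundary G a z) := by
  intro t
  induction t generalizing k l a z with
  | nil => simp [MagnitudeHomology.listBoundary]
  | cons c t ih =>
    intro h
    by_cases h1 : MagnitudeHomology.listBoundary G c (fun s => z (c :: s)) t = 0
    · have h2 : ∃ b, Merges G a b c ∧ z (b :: c :: t) ≠ 0 := by
        by_contra! hcon
        apply h
        rw [MagnitudeHomology.listBoundary, h1, Finset.sum_eq_zero]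
        · simp
        · intro b _
          split_ifs with hb
          · exact hcon b hb
          · rfl
      obtain ⟨b, hb, hzb⟩ := h2
      have := hz _ hzb
      simp only [IsTail, hb.1, hb.2.1, true_and, not_true, false_and, and_false, or_false] at this
      obtain ⟨k', hk, l', rfl, k'', rfl, l'', rfl, h⟩ := this
      obtain rfl : k = k'' + 1 := by omega
      exact (isTail_cons_of_not_adj hb.2.2.1 hb.2.2.2).2 h
    · have key : ∀ s, z (c :: s) ≠ 0 → IsTail G (k + 1) l a (c :: s) := fun s => hz _
      have hne : ∃ s, z (c :: s) ≠ 0 := by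
        by_contra! hcon
        apply h1
        rw [show (fun s => z (c :: s)) = fun _ => 0 from funext hcon, listBoundary_zero]
      obtain ⟨s, hs⟩ := hne
      -- For `k = 0` the chain behind `c` lives on the empty tail only, so its boundary vanishes,
      -- against `h1`.
      have hpos : ∃ k', k = k' + 1 := by
        rcases k with _ | k
        · exfalso
          apply h1
          have : ∀ s, z (c :: s) ≠ 0 → s = [] := by
            intro s hs
            have := key s hs
            cases s with
            | nil => rfl
            | cons d s =>
              simp [IsTail] at this
          cases t with
          | nil => rfl
          | cons d t =>
            have h0 : ∀ (d : V) s, z (c :: d :: s) = 0 := fun d s => by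
              by_contra h
              simpa using this _ h
            simp [MagnitudeHomology.listBoundary, h0, listBoundary_zero]
        · exact ⟨k, rfl⟩
      obtain ⟨k, rfl⟩ := hpos
      by_cases hac : G.Adj a c
      · have := key s hs
        simp only [IsTail, hac, true_and, not_true, false_and, and_false, or_false] at this
        obtain ⟨_, _, l', rfl, _⟩ := this
        refine (isTail_cons_of_adj hac).2 (ih (fun s hs => ?_) h1)
        exact (isTail_cons_of_adj hac).1 (key s hs)
      · have := key s hs
        simp only [IsTail, hac, false_and, false_or] at this
        obtain ⟨_, _, hne, _, l', rfl, _⟩ := this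
        refine (isTail_cons_of_not_adj hne hac).2 (ih (fun s hs => ?_) h1)
        exact (isTail_cons_of_not_adj hne hac).1 (key s hs)

omit [Fintype V] in
theorem isTail_cons_iff {k l : ℕ} {a b : V} {t : List V} :
    IsTail G k l a (b :: t) ↔ ∃ k', k = k' + 1 ∧
      ((G.Adj a b ∧ ∃ l', l = l' + 1 ∧ IsTail G k' l' b t) ∨
        (a ≠ b ∧ ¬ G.Adj a b ∧ ∃ l', l = l' + 2 ∧ IsTail G k' l' b t)) := by
  simp only [IsTail]

/-- A relative form of pawfulness: midpoints of `a` and `c` close to a neighbour of `a`. -/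
def HasNearMidpoints (G : SimpleGraph V) : Prop :=
  ∀ p a c : V, p = a ∨ G.Adj p a → a ≠ c → ¬ G.Adj a c →
    ∃ m, G.Adj a m ∧ G.Adj m c ∧ (p = m ∨ G.Adj p m)

/-- The filler is `m` followed by a cycle `u` starting at `m`, where `u` is `-(c, z)` corrected by
inductively constructed fillers. The control of first vertices by `p` is part of the induction: it
keeps the corrections invisible when `m` is omitted. -/
theorem exists_listBoundary_eq_consChain (hG : HasNearMidpoints G) (k l : ℕ) (p a c : V)
    (hp : p = a ∨ G.Adj p a) (hac : a ≠ c) (hadj : ¬ G.Adj a c) (z : List V → ℤ)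
    (hz : IsChainOn G k l c z) (hcyc : ∀ t, listBoundary G c z t = 0) :
    ∃ y, IsChainOn G (k + 2) (l + 2) a y ∧
      (∀ x t, y (x :: t) ≠ 0 → p = x ∨ G.Adj p x) ∧
      ∀ t, listBoundary G a y t = consChain c z t := by
  induction k using Nat.strong_induction_on generalizing l p a c z with
  | _ k ih =>
  obtain ⟨m, ham, hmc, hpm⟩ := hG p a c hp hac hadj
  have hv : ∀ x, ∃ v, Merges G m c x → IsChainOn G (k + 1) (l + 1) m v ∧
      (∀ x' t, v (x' :: t) ≠ 0 → a = x' ∨ G.Adj a x') ∧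
      ∀ t, listBoundary G m v t = consChain x (fun s => z (x :: s)) t := by
    intro x
    by_cases h0 : ∀ s, z (x :: s) = 0
    · refine ⟨fun _ => 0, fun _ => ⟨fun t h => (h rfl).elim, fun _ _ h => (h rfl).elim, fun t => ?_⟩⟩
      rw [listBoundary_zero]
      cases t <;> simp [consChain, h0]
    · by_cases hx : Merges G m c x
      · push Not at h0
        obtain ⟨s, hs⟩ := h0
        have := hz _ hs
        simp only [isTail_cons_iff, hx.2.1, true_and, not_true, false_and, and_false,
          or_false] at this
        obtain ⟨k', rfl, l', rfl, -⟩ := this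
        -- The roles shift: `a` becomes the reference vertex `p`, and the pair to be bridged is now
        -- `m, x`.
        obtain ⟨v, hv⟩ := ih k' (Nat.lt_succ_self _) l' a m x (Or.inr ham) hx.2.2.1 hx.2.2.2
          (fun s => z (x :: s)) (fun s hs => (isTail_cons_of_adj hx.2.1).1 (hz _ hs))
          (fun t => by
            have := hcyc (x :: t)
            rwa [listBoundary_cons_of_adj hx.2.1, neg_eq_zero] at this)
        exact ⟨v, fun _ => hv⟩
      · exact ⟨fun _ => 0, fun h => (hx h).elim⟩
  choose v hv using hv
  let w : List V → ℤ := fun s => ∑ x, if Merges G m c x then v x s else 0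
  have hw : ∀ s, w s ≠ 0 → ∃ x, Merges G m c x ∧ v x s ≠ 0 := by
    intro s hs
    obtain ⟨x, -, hx⟩ := Finset.exists_ne_zero_of_sum_ne_zero hs
    split_ifs at hx with h
    · exact ⟨x, h, hx⟩
    · exact (hx rfl).elim
  let u : List V → ℤ := fun s => -(consChain c z s + w s)
  -- Since `z` is a cycle, the boundary of `(c, z)` consists only of the terms omitting `c`, and
  -- these cancel against the boundaries of the `v x`.
  have hu : ∀ t, listBoundary G m u t = 0 := by
    intro t
    simp only [u, w]
    rw [listBoundary_neg, listBoundary_add, listBoundary_sum]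
    beta_reduce
    cases t with
    | nil => simp [listBoundary]
    | cons x t =>
      have h1 : consChain c (listBoundary G c z) (x :: t) = 0 := by simp [consChain, hcyc]
      rw [listBoundary_consChain, h1, Finset.sum_eq_single x]
      · simp only [listBoundary_ite]
        split_ifs with h
        · rw [(hv x h).2.2]
          simp [consChain]
        · simp
      · intro b _ hb
        simp only [listBoundary_ite]
        split_ifs with h
        · rw [(hv b h).2.2]
          simp [consChain, hb.symm]
        · rfl
      · simp
  refine ⟨consChain m u, ?_, ?_, ?_⟩
  · rintro (_ | ⟨x, t⟩) h
    · exact (h rfl).elim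
    · simp only [consChain, ne_eq, ite_eq_right_iff, Classical.not_imp] at h
      obtain ⟨rfl, h⟩ := h
      refine (isTail_cons_of_adj ham).2 ?_
      by_cases hwt : w t = 0
      · cases t with
        | nil => simp [u, hwt, consChain] at h
        | cons b t =>
          simp only [u, hwt, consChain, add_zero, neg_eq_zero, ite_eq_right_iff,
            Classical.not_imp] at h
          obtain ⟨rfl, h⟩ := h
          exact (isTail_cons_of_adj hmc).2 (hz _ h)
      · obtain ⟨b, hb, hbt⟩ := hw t hwt
        exact (hv b hb).1 _ hbt
  · intro x t h
    simp only [consChain, ne_eq, ite_eq_right_iff, Classical.not_imp] at h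
    exact h.1 ▸ hpm
  · intro t
    cases t with
    | nil => rfl
    | cons x t =>
      rw [listBoundary_consChain]
      have h1 : consChain m (listBoundary G m u) (x :: t) = 0 := by simp [consChain, hu]
      rw [h1]
      split_ifs with h
      -- Sequences in `w` begin at `a` or a neighbour of `a`, so `m` cannot be omitted in front of
      -- them.
      · have hwt : w (x :: t) = 0 := by
          by_contra hne
          obtain ⟨b, hb, hbt⟩ := hw _ hne
          exact ((hv b hb).2.1 _ _ hbt).elim h.2.2.1 h.2.2.2
        simp [u, hwt]
      · have hxc : x ≠ c := by
          rintro rfl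
          exact h ⟨ham, hmc, hac, hadj⟩
        simp [consChain, hxc]

/-- Sequences beginning with an edge are removed by induction on the degree, as dropping that edge
lowers both degree and length by one and keeps `k < l`. Sequences beginning with a step of length
two are handled by the preceding lemma. -/
theorem exists_listBoundary_eq (hG : HasNearMidpoints G) (k l : ℕ) (hkl : k < l) (a : V)
    (z : List V → ℤ) (hz : IsChainOn G k l a z) (hcyc : ∀ t, listBoundary G a z t = 0) :
    ∃ y, IsChainOn G (k + 1) l a y ∧ ∀ t, listBoundary G a y t = z t := by
  induction k generalizing l a z with
  | zero =>
    refine ⟨fun _ => 0, fun t h => (h rfl).elim, fun t => ?_⟩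
    rw [listBoundary_zero]
    by_contra h
    have := hz t (Ne.symm h)
    cases t with
    | nil => exact hkl.ne' this.2
    | cons b t => simp [IsTail] at this
  | succ k ih =>
    obtain ⟨l, rfl⟩ : ∃ l', l = l' + 2 := ⟨l - 2, by omega⟩
    have hw : ∀ x, ∃ w, G.Adj a x → IsChainOn G (k + 1) (l + 1) x w ∧
        ∀ t, listBoundary G x w t = z (x :: t) := by
      intro x
      by_cases hx : G.Adj a x
      · obtain ⟨w, hw⟩ := ih (l + 1) (by omega) x (fun s => z (x :: s))
          (fun s hs => (isTail_cons_of_adj hx).1 (hz _ hs))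
          (fun t => by
            have := hcyc (x :: t)
            rwa [listBoundary_cons_of_adj hx, neg_eq_zero] at this)
        exact ⟨w, fun _ => hw⟩
      · exact ⟨fun _ => 0, fun h => (hx h).elim⟩
    choose w hw using hw
    -- The minus sign compensates the one in `listBoundary_cons_of_adj`.
    let y₁ : List V → ℤ := fun s => match s with
      | [] => 0
      | x :: t => if G.Adj a x then -w x t else 0
    have hy₁ : IsChainOn G (k + 2) (l + 2) a y₁ := by
      rintro (_ | ⟨x, t⟩) h
      · exact (h rfl).elim
      · by_cases hx : G.Adj a x
        · refine (isTail_cons_of_adj hx).2 ((hw x hx).1 _ ?_)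
          simpa [y₁, hx] using h
        · simp [y₁, hx] at h
    let z' : List V → ℤ := fun s => z s + -listBoundary G a y₁ s
    have hz' : IsChainOn G (k + 1) (l + 2) a z' := by
      intro t ht
      by_cases h : z t = 0
      · refine hy₁.listBoundary t ?_
        simpa [z', h] using ht
      · exact hz _ h
    have hz'cyc : ∀ t, listBoundary G a z' t = 0 := by
      intro t
      simp only [z']
      rw [listBoundary_add, listBoundary_neg, listBoundary_listBoundary]
      simp [hcyc]
    have hz'adj : ∀ x t, G.Adj a x → z' (x :: t) = 0 := by
      intro x t hx
      simp only [z', listBoundary_cons_of_adj hx, y₁, hx, if_true, listBoundary_neg,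
        (hw x hx).2]
      simp
    have hz'a : ∀ t, z' (a :: t) = 0 := by
      intro t
      by_contra h
      have := hz' _ h
      simp [isTail_cons_iff] at this
    have hv : ∀ x, ∃ v, IsChainOn G (k + 2) (l + 2) a v ∧
        ∀ t, listBoundary G a v t = consChain x (fun s => z' (x :: s)) t := by
      intro x
      by_cases hx : a ≠ x ∧ ¬ G.Adj a x
      -- With no outer constraint, `p = a` serves. The part of `z'` behind `x` is a cycle because an
      -- omission in front of `x` would need a sequence beginning with an edge, where `z'` vanishes.
      · obtain ⟨v, hv, -, hv'⟩ := exists_listBoundary_eq_consChain hG k l a a x (Or.inl rfl)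
          hx.1 hx.2 (fun s => z' (x :: s))
          (fun s hs => (isTail_cons_of_not_adj hx.1 hx.2).1 (hz' _ hs))
          (fun t => by
            have := hz'cyc (x :: t)
            rw [listBoundary, Finset.sum_eq_zero] at this
            · simpa using this
            · intro b _
              split_ifs with hb
              · exact hz'adj _ _ hb.1
              · rfl)
        exact ⟨v, hv, hv'⟩
      · refine ⟨fun _ => 0, fun t h => (h rfl).elim, fun t => ?_⟩
        have h0 : ∀ s, z' (x :: s) = 0 := by
          intro s
          by_cases hax : a = x
          · exact hax ▸ hz'a s
          · exact hz'adj _ _ (by tauto)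
        rw [listBoundary_zero]
        cases t <;> simp [consChain, h0]
    choose v hv hv' using hv
    refine ⟨fun s => y₁ s + ∑ x, v x s, ?_, ?_⟩
    · intro t ht
      beta_reduce at ht
      rcases eq_or_ne (y₁ t) 0 with h | h
      · simp only [h, zero_add] at ht
        obtain ⟨x, -, hx⟩ := Finset.exists_ne_zero_of_sum_ne_zero ht
        exact hv x _ hx
      · exact hy₁ _ h
    · intro t
      rw [listBoundary_add, listBoundary_sum]
      simp only [hv']
      cases t with
      | nil =>
        by_contra h
        have := hz [] (fun h0 => h (by simp [h0, listBoundary, consChain]))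
        simp [IsTail] at this
      | cons x t =>
        simp [consChain, z']

end ListChains

end MagnitudeHomology
namespace MagnitudeHomology

/-! ### Pawful graphs, joins and complements of cycles -/

section Pawful

open SimpleGraph

variable {V : Type u} {G : SimpleGraph V}

open Classical in
theorem IsPawful.edist_eq (hG : IsPawful G) (a b : V) :
    G.edist a b = if a = b then 0 else if G.Adj a b then 1 else 2 := by
  split_ifs with h1 h2
  · exact edist_eq_zero_iff.2 h1
  · exact edist_eq_one_iff_adj.2 h2
  · refine le_antisymm (ediam_le_iff.1 hG.2.1 a b) ?_
    have : ¬ G.edist a b ≤ 1 := by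
      rw [edist_le_one_iff_adj_or_eq]; tauto
    exact Order.add_one_le_of_lt (not_le.1 this)

theorem IsPawful.dist_eq_two (hG : IsPawful G) {a b : V} (h : a ≠ b) (h' : ¬ G.Adj a b) :
    G.dist a b = 2 := by
  have := hG.edist_eq a b
  rw [if_neg h, if_neg h'] at this
  rw [SimpleGraph.dist, this]
  rfl

theorem IsPawful.hasNearMidpoints (hG : IsPawful G) : HasNearMidpoints G := by
  intro p a c hp hac hadj
  have hmid : ∃ m, G.Adj a m ∧ G.Adj m c := by
    have := hG.edist_eq a c
    rw [if_neg hac, if_neg hadj, edist_eq_two_iff] at this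
    obtain ⟨m, hm⟩ := this.2.2
    rw [mem_commonNeighbors] at hm
    exact ⟨m, hm.1, hm.2.symm⟩
  rcases hp with rfl | hp
  · obtain ⟨m, h1, h2⟩ := hmid
    exact ⟨m, h1, h2, Or.inr h1⟩
  · by_cases hpc : G.Adj p c
    -- Here `p` itself is a midpoint; otherwise `c` is at distance two from both ends of the edge
    -- `a, p`, which is the pawful configuration.
    · exact ⟨p, hp.symm, hpc, Or.inl rfl⟩
    · have hne : p ≠ c := by
        rintro rfl
        exact hadj hp.symm
      obtain ⟨x, h1, h2, h3⟩ := hG.2.2 a c p (hG.dist_eq_two hac hadj)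
        (hG.dist_eq_two hne.symm fun h => hpc h.symm) (dist_eq_one_iff_adj.2 hp.symm)
      rw [dist_eq_one_iff_adj] at h1 h2 h3
      exact ⟨x, h1.symm, h2, Or.inr h3.symm⟩

theorem isPawful_of_adj [Nonempty V] (h2 : ∀ a b, a ≠ b → ¬ G.Adj a b → ∃ m, G.Adj a m ∧ G.Adj m b)
    (h3 : ∀ u v w, u ≠ v → ¬ G.Adj u v → v ≠ w → ¬ G.Adj v w →
      ∃ x, G.Adj x u ∧ G.Adj x v ∧ G.Adj x w) : IsPawful G := by
  have hd : G.ediam ≤ 2 := by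
    refine ediam_le_of_edist_le fun a b => ?_
    by_cases h : G.edist a b ≤ 1
    · exact h.trans (by norm_num)
    · rw [edist_le_one_iff_adj_or_eq, not_or] at h
      obtain ⟨m, h4, h5⟩ := h2 a b h.2 h.1
      exact edist_le (Walk.cons h4 (Walk.cons h5 Walk.nil))
  have hne : ∀ u v, G.dist u v = 2 → u ≠ v ∧ ¬ G.Adj u v := by
    refine fun u v h => ⟨?_, fun h' => ?_⟩
    · rintro rfl
      simp at h
    · rw [dist_eq_one_iff_adj.2 h'] at h
      omega
  refine ⟨connected_of_ediam_ne_top fun h => ?_, hd, fun u v w huv hvw _ => ?_⟩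
  · rw [h] at hd
    exact absurd hd (by decide)
  · simp only [dist_eq_one_iff_adj]
    exact h3 u v w (hne _ _ huv).1 (hne _ _ huv).2 (hne _ _ hvw).1 (hne _ _ hvw).2

/-- Records the two sides of the join as colours on `V` itself, so that later arguments need no
isomorphism. -/
theorem IsJoin.exists_coloring (h : IsJoin G) :
    ∃ f : V → Bool, Function.Surjective f ∧ ∀ a b, f a ≠ f b → G.Adj a b := by
  obtain ⟨A, B, H, K, ⟨a₀⟩, ⟨b₀⟩, ⟨e⟩⟩ := h
  refine ⟨fun v => (e v).isLeft, ?_, fun a b hab => ?_⟩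
  · rintro (_ | _)
    · exact ⟨e.symm (Sum.inr b₀), by simp⟩
    · exact ⟨e.symm (Sum.inl a₀), by simp⟩
  · rw [← e.map_adj_iff]
    revert hab
    beta_reduce
    rcases e a with a | a <;> rcases e b with b | b <;> simp [join]

theorem IsJoin.isPawful (h : IsJoin G) : IsPawful G := by
  obtain ⟨f, hf, hadj⟩ := h.exists_coloring
  have hx : ∀ v, ∃ x, f x ≠ f v := fun v => by
    obtain ⟨x, hx⟩ := hf (!f v)
    exact ⟨x, by simp [hx]⟩
  have : Nonempty V := ⟨(hf true).choose⟩
  refine isPawful_of_adj (fun a b _ hab => ?_) fun u v w _ huv _ hvw => ?_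
  · obtain ⟨x, hx⟩ := hx a
    have : f a = f b := by by_contra h; exact hab (hadj _ _ h)
    exact ⟨x, hadj _ _ hx.symm, hadj _ _ (this ▸ hx)⟩
  · obtain ⟨x, hx⟩ := hx v
    have h1 : f u = f v := by by_contra h; exact huv (hadj _ _ h)
    have h2 : f v = f w := by by_contra h; exact hvw (hadj _ _ h)
    exact ⟨x, hadj _ _ (h1 ▸ hx), hadj _ _ hx, hadj _ _ (h2 ▸ hx)⟩

theorem cycleGraph_adj_iff_val {n : ℕ} (hn : 2 ≤ n) (u v : Fin n) :
    (cycleGraph n).Adj u v ↔ v.val = u.val + 1 ∨ u.val = v.val + 1 ∨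
      v.val + n = u.val + 1 ∨ u.val + n = v.val + 1 := by
  obtain ⟨n, rfl⟩ : ∃ m, n = m + 2 := ⟨n - 2, by omega⟩
  rw [cycleGraph_adj, sub_eq_iff_eq_add, sub_eq_iff_eq_add, Fin.ext_iff, Fin.ext_iff,
    add_comm 1, add_comm 1, Fin.val_add_one, Fin.val_add_one]
  simp only [Fin.ext_iff, Fin.val_last]
  have := u.is_lt
  have := v.is_lt
  split_ifs <;> omega

theorem isPawful_compl_cycleGraph {n : ℕ} (hn : 6 ≤ n) : IsPawful (cycleGraph n)ᶜ := by
  have : NeZero n := ⟨by omega⟩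
  have hadj : ∀ u v : Fin n, (cycleGraph n)ᶜ.Adj u v ↔ u.val ≠ v.val ∧
      ¬ (v.val = u.val + 1 ∨ u.val = v.val + 1 ∨ v.val + n = u.val + 1 ∨ u.val + n = v.val + 1) := by
    intro u v
    rw [compl_adj, cycleGraph_adj_iff_val (by omega), ne_eq, ne_eq, Fin.ext_iff]
  -- Non-neighbours of `v` in the complement are `v ± 1`. The vertex `v + 3` modulo `n` has cyclic
  -- distance at least two from `v - 1`, `v` and `v + 1` once `n ≥ 6`.
  have key : ∀ v : Fin n, ∃ x : Fin n, (x.val = v.val + 3 ∨ x.val + n = v.val + 3) := by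
    intro v
    by_cases h : v.val + 3 < n
    · exact ⟨⟨v.val + 3, h⟩, Or.inl rfl⟩
    · exact ⟨⟨v.val + 3 - n, by omega⟩, Or.inr (by simp; omega)⟩
  refine isPawful_of_adj (fun a b hab h => ?_) fun u v w huv huv' hvw hvw' => ?_
  · obtain ⟨x, hx⟩ := key a
    rw [ne_eq, Fin.ext_iff] at hab
    refine ⟨x, ?_⟩
    simp only [hadj] at h ⊢
    omega
  · obtain ⟨x, hx⟩ := key v
    rw [ne_eq, Fin.ext_iff] at huv hvw
    refine ⟨x, ?_⟩
    simp only [hadj] at huv' hvw' ⊢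
    omega

/-- The colouring of a join is constant along edges of the complement, hence constant if that is
connected, but both colours occur. -/
theorem not_isJoin_compl_of_connected (h : G.Connected) : ¬ IsJoin Gᶜ := by
  intro hj
  obtain ⟨f, hf, hadj⟩ := hj.exists_coloring
  have hconst : ∀ a b, G.Adj a b → f a = f b := by
    intro a b hab
    by_contra hne
    have := hadj _ _ hne
    rw [compl_adj] at this
    exact this.2 hab
  obtain ⟨x, hx⟩ := hf true
  obtain ⟨y, hy⟩ := hf false
  obtain ⟨p⟩ := h.preconnected x y
  have : f x = f y := by
    clear hx hy
    induction p with
    | nil => rfl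
    | cons h _ ih => exact (hconst _ _ h).trans ih
  simp [hx, hy] at this

end Pawful

end MagnitudeHomology
namespace MagnitudeHomology

/-! ### Comparison with the magnitude complex, and diagonality -/

section Translation

open SimpleGraph CategoryTheory
open scoped Classical

variable {V : Type u} {G : SimpleGraph V}

/-- A chain of the magnitude complex as a function on lists of vertices. -/
noncomputable def toListChain (G : SimpleGraph V) (k l : ℕ) :
    (Generator G k l →₀ ℤ) →ₗ[ℤ] (List V →₀ ℤ) :=
  Finsupp.lmapDomain ℤ ℤ fun x => List.ofFn x.seq

theorem ofFn_seq_injective (k l : ℕ) :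
    Function.Injective fun x : Generator G k l => List.ofFn x.seq :=
  fun _ _ h => Generator.ext (List.ofFn_injective h)

theorem IsPawful.isTail_ofFn_iff (hG : IsPawful G) (k l : ℕ) (x : Fin (k + 1) → V) :
    IsTail G k l (x 0) (List.ofFn fun j : Fin k => x j.succ) ↔
      (∀ i : Fin k, x i.castSucc ≠ x i.succ) ∧ length G x = (l : ℕ∞) := by
  induction k generalizing l with
  | zero => simp [IsTail, length, eq_comm]
  | succ k ih =>
    have hone : ∀ n : ℕ, ∀ N : ℕ∞,
        (n : ℕ∞) + N = (l : ℕ∞) ↔ ∃ l', l = l' + n ∧ N = (l' : ℕ∞) := by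
      intro n N
      cases N with
      | top => simp
      | coe N =>
        norm_cast
        exact ⟨fun h => ⟨N, by omega, rfl⟩, fun ⟨l', h1, h2⟩ => by omega⟩
    have ih' := fun l' => ih l' (fun j => x j.succ)
    rw [List.ofFn_succ, isTail_cons_iff, length_succ, hG.edist_eq, Fin.forall_fin_succ]
    simp only [Nat.add_right_cancel_iff, exists_eq_left']
    change (G.Adj (x 0) (x 1) ∧ (∃ l', l = l' + 1 ∧ IsTail G k l' (x 1) _) ∨
      x 0 ≠ x 1 ∧ ¬ G.Adj (x 0) (x 1) ∧ ∃ l', l = l' + 2 ∧ IsTail G k l' (x 1) _) ↔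
      (x 0 ≠ x 1 ∧ ∀ i : Fin k, x i.castSucc.succ ≠ x i.succ.succ) ∧ _
    have ih'' : ∀ l', IsTail G k l' (x 1) (List.ofFn fun j : Fin k => x j.succ.succ) ↔
        (∀ i : Fin k, x i.castSucc.succ ≠ x i.succ.succ) ∧
          length G (fun j => x j.succ) = (l' : ℕ∞) := ih'
    have h1 := hone 1
    have h2 := hone 2
    push_cast at h1 h2
    by_cases h01 : x 0 = x 1
    · simp [h01]
    · by_cases hadj : G.Adj (x 0) (x 1)
      · simp only [hadj, h01, h1, ih'', if_true, if_false, true_and, not_true, false_and,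
          and_false, or_false, ne_eq, not_false_eq_true]
        exact ⟨fun ⟨l', h, h', h''⟩ => ⟨h', l', h, h''⟩, fun ⟨h', l', h, h''⟩ => ⟨l', h, h', h''⟩⟩
      · simp only [hadj, h01, h2, ih'', if_false, true_and, false_and, false_or, ne_eq,
          not_false_eq_true]
        exact ⟨fun ⟨l', h, h', h''⟩ => ⟨h', l', h, h''⟩, fun ⟨h', l', h, h''⟩ => ⟨l', h, h', h''⟩⟩

theorem IsPawful.exists_generator_iff (hG : IsPawful G) (k l : ℕ) (a : V) (t : List V) :
    (∃ x : Generator G k l, List.ofFn x.seq = a :: t) ↔ IsTail G k l a t := by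
  constructor
  · rintro ⟨x, hx⟩
    rw [List.ofFn_succ, List.cons.injEq] at hx
    rw [← hx.1, ← hx.2]
    exact (hG.isTail_ofFn_iff k l x.seq).2 ⟨x.ne, x.length_eq⟩
  · intro h
    have hlen : ∀ (k l : ℕ) (a : V) (t : List V), IsTail G k l a t → t.length = k := by
      intro k l a t h
      induction t generalizing k l a with
      | nil => exact h.1.symm
      | cons b t ih =>
        obtain ⟨k', rfl, ⟨_, l', _, h⟩ | ⟨_, _, l', _, h⟩⟩ := isTail_cons_iff.1 h <;>
          rw [List.length_cons, ih _ _ _ h]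
    obtain rfl := hlen _ _ _ _ h
    have h' := (hG.isTail_ofFn_iff t.length l (a :: t).get).1 (by simpa using h)
    exact ⟨⟨(a :: t).get, h'.1, h'.2⟩, by simp⟩

theorem listBoundary_single_cons [Fintype V] (a b : V) (L : List V) (x : V) (t : List V) :
    listBoundary G a (fun s => Finsupp.single (b :: L) (1 : ℤ) s) (x :: t) =
      -(if Merges G a b x then Finsupp.single L (1 : ℤ) (x :: t) else 0) -
        if x = b then listBoundary G b (fun s => Finsupp.single L (1 : ℤ) s) t else 0 := by
  have : (fun s => Finsupp.single (b :: L) (1 : ℤ) s) =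
      consChain b fun s => Finsupp.single L (1 : ℤ) s := by
    funext s
    cases s with
    | nil => simp [consChain]
    | cons c s =>
      simp only [consChain, Finsupp.single_apply, List.cons.injEq, eq_comm (a := b)]
      split_ifs <;> tauto
  rw [this, listBoundary_consChain]
  rfl

theorem listBoundary_single_nil [Fintype V] (a : V) (t : List V) :
    listBoundary G a (fun s => Finsupp.single [] (1 : ℤ) s) t = 0 := by
  cases t with
  | nil => rfl
  | cons x t =>
    simp only [listBoundary, Finsupp.single_apply, reduceCtorEq, if_false, ite_self,
      Finset.sum_const_zero, listBoundary_zero]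
    rfl

/-- Unfolds the recursion: each vertex passed contributes a factor `-1`, which produces the
alternating signs. -/
theorem listBoundary_single_ofFn [Fintype V] (k : ℕ) (x : Fin (k + 2) → V) (t : List V) :
    listBoundary G (x 0)
      (fun s => Finsupp.single (List.ofFn fun j : Fin (k + 1) => x j.succ) (1 : ℤ) s) t =
      ∑ i : Fin k, (-1 : ℤ) ^ (i.val + 1) *
        if Merges G (x i.castSucc.castSucc) (x i.castSucc.succ) (x i.succ.succ) then
          Finsupp.single (List.ofFn (omit1 x i)) (1 : ℤ) (x 0 :: t) else 0 := by
  induction k generalizing t with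
  | zero =>
    cases t with
    | nil => simp [listBoundary]
    | cons c t =>
      simp only [List.ofFn_succ, List.ofFn_zero]
      rw [listBoundary_single_cons, listBoundary_single_nil]
      simp
  | succ k ih =>
    have ih' := fun t => ih (fun j => x j.succ) t
    cases t with
    | nil =>
      rw [listBoundary, Finset.sum_eq_zero]
      intro i _
      rw [Finsupp.single_eq_of_ne, ite_self, mul_zero]
      intro h
      have := congrArg List.length h
      simp at this
    | cons c t =>
      rw [List.ofFn_succ, listBoundary_single_cons, Fin.sum_univ_succ, sub_eq_add_neg]
      congr 1
      · have h0 : List.ofFn (omit1 x 0) = x 0 :: List.ofFn fun j : Fin (k + 1) => x j.succ.succ := by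
          rw [List.ofFn_succ]
          simp only [omit1_zero_zero, omit1_zero_succ]
        have h2 : (List.ofFn fun j : Fin (k + 1) => x j.succ.succ) =
            x 2 :: List.ofFn fun j : Fin k => x j.succ.succ.succ := by
          rw [List.ofFn_succ]
          rfl
        change _ = (-1 : ℤ) ^ (0 + 1) * if Merges G (x 0) (x 1) (x 2) then _ else 0
        rw [h0, h2]
        by_cases hc : c = x 2
        · simp only [Finsupp.single_apply, hc, List.cons.injEq, true_and, Fin.succ_zero_eq_one]
          split_ifs <;> simp
        · simp [hc]
      · have hsucc : ∀ i : Fin k, List.ofFn (omit1 x i.succ) =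
            x 0 :: List.ofFn (omit1 (fun j => x j.succ) i) := by
          intro i
          rw [List.ofFn_succ]
          simp only [omit1_succ_zero, omit1_succ_succ]
        change -(if c = x 1 then listBoundary G (x 1) (fun s => Finsupp.single
          (List.ofFn fun j : Fin (k + 1) => x j.succ.succ) (1 : ℤ) s) t else 0) = _
        simp only [hsucc]
        split_ifs with hc
        · subst hc
          refine (congrArg Neg.neg (ih' t)).trans ?_
          rw [← Finset.sum_neg_distrib]
          refine Finset.sum_congr rfl fun i _ => ?_
          rw [Fin.val_succ, pow_succ _ (i.val + 1)]
          simp only [Finsupp.single_apply, List.cons.injEq, true_and]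
          change -(_ * if Merges G (x i.succ.castSucc.castSucc) (x i.succ.castSucc.succ)
            (x i.succ.succ.succ) then _ else _) = _
          simp only [Fin.succ_zero_eq_one]
          split_ifs <;> simp_all [-List.ofFn_succ]
        · rw [neg_zero, Finset.sum_eq_zero]
          intro i _
          rw [Finsupp.single_eq_of_ne, ite_self, mul_zero]
          rw [List.ofFn_succ]
          intro h
          simp only [List.cons.injEq, true_and] at h
          refine hc (h.1.trans ?_)
          cases k with
          | zero => exact i.elim0
          | succ k => rfl

/-- Length is kept exactly when the triangle inequality is an equality; with nonzero steps and
distances at most two, this can only read `2 = 1 + 1`. -/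
theorem IsPawful.length_omit1_eq_iff (hG : IsPawful G) {k l : ℕ} (x : Generator G (k + 1) l)
    (i : Fin k) : length G (omit1 x.seq i) = length G x.seq ↔
      Merges G (x.seq i.castSucc.castSucc) (x.seq i.castSucc.succ) (x.seq i.succ.succ) := by
  have h := length_omit1 G x.seq i
  have hfin : length G x.seq ≠ ⊤ := by
    rw [x.length_eq]
    exact ENat.natCast_ne_top l
  have h1 := x.ne i.castSucc
  have h2 := x.ne i.succ
  change x.seq i.castSucc.succ ≠ _ at h2
  have hiff : length G (omit1 x.seq i) = length G x.seq ↔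
      G.edist (x.seq i.castSucc.castSucc) (x.seq i.succ.succ) =
        G.edist (x.seq i.castSucc.castSucc) (x.seq i.castSucc.succ) +
          G.edist (x.seq i.castSucc.succ) (x.seq i.succ.succ) := by
    constructor
    · intro h'
      rw [h'] at h
      exact ENat.add_right_injective_of_ne_top hfin h
    · intro h'
      rw [h'] at h
      refine (ENat.add_left_injective_of_ne_top ?_ h).symm
      simp only [hG.edist_eq]
      split_ifs <;> decide
  rw [hiff]
  simp only [hG.edist_eq, Merges, h1, h2, if_false]
  split_ifs <;> simp_all <;> decide

theorem IsPawful.toListChain_boundary [Fintype V] (hG : IsPawful G) (k l : ℕ)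
    (z : Generator G (k + 1) l →₀ ℤ) (a : V) (t : List V) :
    toListChain G k l (boundary G k l z) (a :: t) =
      listBoundary G a (fun s => toListChain G (k + 1) l z (a :: s)) t := by
  induction z using Finsupp.induction_linear with
  | zero => simp [listBoundary_zero]
  | add y z hy hz =>
    simp only [map_add, Finsupp.add_apply, listBoundary_add, hy, hz]
  | single x r =>
    have hface : ∀ i : Fin k, toListChain G k l (face G i x) = if
        Merges G (x.seq i.castSucc.castSucc) (x.seq i.castSucc.succ) (x.seq i.succ.succ) then
          Finsupp.single (List.ofFn (omit1 x.seq i)) (1 : ℤ) else 0 := by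
      intro i
      rw [face]
      simp only [← hG.length_omit1_eq_iff]
      split_ifs with h
      · simp [toListChain, Finsupp.mapDomain_single]
      · simp
    have hsingle : ∀ s, toListChain G (k + 1) l (Finsupp.single x r) (a :: s) =
        r * if x.seq 0 = a then
          Finsupp.single (List.ofFn fun j : Fin (k + 1) => x.seq j.succ) (1 : ℤ) s else 0 := by
      intro s
      rw [toListChain, Finsupp.lmapDomain_apply, Finsupp.mapDomain_single, List.ofFn_succ]
      simp only [Finsupp.single_apply, List.cons.injEq]
      split_ifs <;> simp_all
    simp only [hsingle]
    rw [listBoundary_mul, listBoundary_ite, boundary, Finsupp.linearCombination_single, map_smul,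
      map_sum, Finsupp.smul_apply, smul_eq_mul, Finsupp.finsetSum_apply]
    congr 1
    simp only [map_smul, hface, Finsupp.smul_apply, smul_eq_mul]
    split_ifs with h
    · subst h
      rw [listBoundary_single_ofFn]
      refine Finset.sum_congr rfl fun i _ => ?_
      split_ifs <;> simp
    · refine Finset.sum_eq_zero fun i _ => ?_
      split_ifs
      · rw [Finsupp.single_eq_of_ne, mul_zero]
        rw [List.ofFn_succ]
        intro h'
        rw [List.cons.injEq] at h'
        refine h (Eq.trans ?_ h'.1.symm)
        cases k with
        | zero => exact Fin.elim0 ‹_›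
        | succ k => rfl
      · simp

theorem IsPawful.exists_boundary_eq [Fintype V] (hG : IsPawful G) {k l : ℕ} (hkl : k + 1 < l)
    (z : Generator G (k + 1) l →₀ ℤ) (hz : boundary G k l z = 0) :
    ∃ y, boundary G (k + 1) l y = z := by
  have hex : ∀ a, ∃ y, IsChainOn G (k + 2) l a y ∧
      ∀ t, listBoundary G a y t = toListChain G (k + 1) l z (a :: t) := by
    intro a
    refine exists_listBoundary_eq hG.hasNearMidpoints (k + 1) l hkl a
      (fun s => toListChain G (k + 1) l z (a :: s)) (fun t ht => ?_) fun t => ?_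
    · rw [← hG.exists_generator_iff]
      by_contra h
      exact ht (Finsupp.mapDomain_of_notMem_range _ _ fun ⟨x, hx⟩ => h ⟨x, hx⟩)
    · rw [← hG.toListChain_boundary, hz]
      simp
  choose y hy hy' using hex
  have : Finite (Generator G (k + 2) l) :=
    Finite.of_injective Generator.seq fun _ _ h => Generator.ext h
  -- The fillers for the different starting vertices are assembled into one chain; there are only
  -- finitely many generators, so the support is finite.
  let Y : Generator G (k + 2) l →₀ ℤ :=
    Finsupp.equivFunOnFinite.symm fun x => y (x.seq 0) (List.ofFn fun j => x.seq (Fin.succ j))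
  have hY : ∀ a t, toListChain G (k + 2) l Y (a :: t) = y a t := by
    intro a t
    by_cases h : ∃ x : Generator G (k + 2) l, List.ofFn x.seq = a :: t
    · obtain ⟨x, hx⟩ := h
      rw [← hx, toListChain, Finsupp.lmapDomain_apply,
        Finsupp.mapDomain_apply (ofFn_seq_injective (k + 2) l)]
      rw [List.ofFn_succ, List.cons.injEq] at hx
      simp only [Y, Finsupp.equivFunOnFinite_symm_apply_apply]
      rw [hx.2, hx.1]
    · rw [toListChain, Finsupp.lmapDomain_apply, Finsupp.mapDomain_of_notMem_range]
      · by_contra hne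
        exact h ((hG.exists_generator_iff _ _ _ _).2 (hy a t (Ne.symm hne)))
      · rintro ⟨x, hx⟩
        exact h ⟨x, hx⟩
  refine ⟨Y, Finsupp.mapDomain_injective (ofFn_seq_injective (k + 1) l) (Finsupp.ext fun s => ?_)⟩
  change toListChain G (k + 1) l _ s = toListChain G (k + 1) l _ s
  cases s with
  | nil =>
    have h0 : ∀ w, toListChain G (k + 1) l w [] = 0 := fun w =>
      Finsupp.mapDomain_of_notMem_range _ _ fun ⟨x, hx⟩ => by simp at hx
    rw [h0, h0]
  | cons a t =>
    rw [hG.toListChain_boundary]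
    simp only [hY]
    exact hy' a t

theorem natCast_le_length (k : ℕ) (x : Fin (k + 1) → V)
    (hx : ∀ i : Fin k, x i.castSucc ≠ x i.succ) : (k : ℕ∞) ≤ length G x := by
  have : ∑ _i : Fin k, (1 : ℕ∞) ≤ length G x :=
    Finset.sum_le_sum fun i _ => Order.one_le_iff_pos.2 (edist_pos_of_ne (hx i))
  simpa using this

theorem isZero_magnitudeComplex_X {k l : ℕ} (h : IsEmpty (Generator G k l)) :
    Limits.IsZero ((magnitudeComplex G l).X k) := by
  have : Subsingleton ((magnitudeComplex G l).X k) :=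
    inferInstanceAs (Subsingleton (Generator G k l →₀ ℤ))
  exact ModuleCat.isZero_of_subsingleton _

theorem IsPawful.isDiagonal [Finite V] (hG : IsPawful G) : IsDiagonal G := by
  intro k l hkl
  have := Fintype.ofFinite V
  rw [MH, ← HomologicalComplex.exactAt_iff_isZero_homology]
  -- Without generators the homology vanishes trivially. A generator forces `k ≤ l`, and `l = 0` if
  -- `k = 0`, so only `0 < k < l` remains.
  by_cases hempty : IsEmpty (Generator G k l)
  · exact ShortComplex.exact_of_isZero_X₂ _ (isZero_magnitudeComplex_X hempty)
  · rw [not_isEmpty_iff] at hempty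
    obtain ⟨x⟩ := hempty
    cases k with
    | zero =>
      have := x.length_eq
      simp only [length, Finset.univ_eq_empty, Finset.sum_empty] at this
      exact (hkl (by exact_mod_cast this)).elim
    | succ k =>
      have hle := natCast_le_length (G := G) (k + 1) x.seq x.ne
      rw [x.length_eq] at hle
      have hle' : k + 1 ≤ l := by exact_mod_cast hle
      rw [HomologicalComplex.exactAt_iff' _ (k + 2) (k + 1) k (by simp) (by simp),
        ShortComplex.moduleCat_exact_iff]
      intro z hz
      have hd : ∀ n, (magnitudeComplex G l).d (n + 1) n = ModuleCat.ofHom (boundary G n l) :=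
        fun n => ChainComplex.of_d (fun k => ModuleCat.of ℤ (Generator G k l →₀ ℤ))
          (fun k => ModuleCat.ofHom (boundary G k l)) n
      change (magnitudeComplex G l).d (k + 1) k z = 0 at hz
      rw [hd] at hz
      obtain ⟨y, hy⟩ := hG.exists_boundary_eq (lt_of_le_of_ne hle' hkl) z hz
      refine ⟨y, ?_⟩
      change (magnitudeComplex G l).d (k + 1 + 1) (k + 1) y = z
      rw [hd]
      exact hy

end Translation

end MagnitudeHomology

theorem mainTheorem1 :
    (∀ (V : Type u) [Finite V] (G : SimpleGraph V),
      MagnitudeHomology.IsPawful G → MagnitudeHomology.IsDiagonal G) ∧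
    (∀ (V : Type u) [Finite V] (G : SimpleGraph V),
      MagnitudeHomology.IsJoin G → MagnitudeHomology.IsPawful G) ∧
    (∀ n : ℕ, 6 ≤ n →
      MagnitudeHomology.IsPawful (SimpleGraph.cycleGraph n)ᶜ ∧
        ¬ MagnitudeHomology.IsJoin (SimpleGraph.cycleGraph n)ᶜ) := by
  refine ⟨fun V _ G h => h.isDiagonal, fun V _ G h => h.isPawful, fun n hn =>
    ⟨MagnitudeHomology.isPawful_compl_cycleGraph hn, ?_⟩⟩
  obtain ⟨m, rfl⟩ : ∃ m, n = m + 1 := ⟨n - 1, by omega⟩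
  exact MagnitudeHomology.not_isJoin_compl_of_connected SimpleGraph.cycleGraph_connected
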